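/- Let $(R,\mathfrak m)$ be a commutative Noetherian local ring, and let all $R$-modules be finitely generated. For an $R$-module $X$, let $\mu(X)$ denote its minimal number of generators, $\dim X$ the Krull dimension of its support, and let $e(X)=\lim_{n\to\infty}\frac{d!}{n^{d}}\,\lambda(X/\mathfrak m^{n+1}X)$, where $d=\dim X$ and $\lambda$ denotes length, be its Hilbert–Samuel multiplicity with respect to $\mathfrak m$ (with $e(0)=0$). The module $X$ is Cohen–Macaulay (CM) if $X=0$ or $\operatorname{depth}X=\dim X$; it has minimal multiplicity if it is CM and $e(X)=\mu(\mathfrak mX)+(1-\dim X)\,\mu(X)$ (for $X=0$ both sides are read as $0$); it is Ulrich if it is nonzero, CM, and $e(X)=\mu(X)$. Let $L$, $M$ and $N$ be $R$-modules such that $M$ and $N$ are CM of the same dimension, $M$ has minimal multiplicity, $\mu(M)=\mu(N)$, and there exists an exact sequence $0\to L\to M\to N\to 0$. Then either $L=0$, or $L$ is Ulrich. -/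

import Mathlib

open IsLocalRing Filter Topology

namespace UlrichCM

section

variable (R : Type*) [CommRing R] (M : Type*) [AddCommGroup M] [Module R M]

/-- `μ(M)`: the minimal number of generators of a finitely generated module. -/
noncomputable def minGens : ℕ := (⊤ : Submodule R M).spanFinrank

/-- The Krull dimension of the support of `M` as a natural number
(it is finite for a nonzero finitely generated module over a Noetherian local ring);
the value for `M = 0` is `0`. -/
noncomputable def dimNat : ℕ := ((Module.supportDim R M).unbotD 0).toNat

variable [IsLocalRing R]

/-- `depth M` for a nonzero finitely generated module over a Noetherian local ring: the supremum
of the lengths of the `M`-regular sequences in the maximal ideal. -/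
noncomputable def depth : ℕ∞ :=
  ⨆ rs : {rs : List R // (∀ x ∈ rs, x ∈ maximalIdeal R) ∧ RingTheory.Sequence.IsRegular M rs},
    (rs.1.length : ℕ∞)

/-- `M` is Cohen-Macaulay: `M = 0` or `depth M = dim M`. -/
def IsCM : Prop :=
  Subsingleton M ∨ (depth R M : WithBot ℕ∞) = Module.supportDim R M

/-- The Hilbert-Samuel function `n ↦ λ(M / 𝔪 ^ (n + 1) M)` of `M`. -/
noncomputable def hilbertSamuel (n : ℕ) : ℕ :=
  (Module.length R (M ⧸ (maximalIdeal R ^ (n + 1) • ⊤ : Submodule R M))).toNat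

/-- `e(M) = e`: the Hilbert-Samuel multiplicity of `M` with respect to the maximal ideal is `e`,
i.e. `e = lim (d! / n ^ d) λ(M / 𝔪 ^ (n + 1) M)` where `d = dim M`. -/
def HasMultiplicity (e : ℝ) : Prop :=
  Tendsto (fun n : ℕ ↦ ((dimNat R M).factorial : ℝ) / (n : ℝ) ^ dimNat R M * hilbertSamuel R M n)
    atTop (𝓝 e)

/-- `M` has minimal multiplicity: it is Cohen-Macaulay and
`e(M) = μ(𝔪 M) + (1 - dim M) μ(M)`. -/
def HasMinimalMultiplicity : Prop :=
  IsCM R M ∧ HasMultiplicity R M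
    (minGens R ((maximalIdeal R) • ⊤ : Submodule R M) + (1 - (dimNat R M : ℝ)) * minGens R M)

/-- `M` is Ulrich: it is nonzero, Cohen-Macaulay, and `e(M) = μ(M)`. -/
def IsUlrich : Prop :=
  Nontrivial M ∧ IsCM R M ∧ HasMultiplicity R M (minGens R M)

end

end UlrichCM

/-!
Write `H_X(n) = λ(X / 𝔪ⁿ⁺¹X)` for the Hilbert-Samuel function, so that `μ(X) = H_X(0)` and
`μ(𝔪X) = H_X(1) - H_X(0)`; let `d` be the common dimension of `M` and `N`.

All data of the theorem are invariant under the flat local extension `R → R[X]_{𝔪R[X]}`, which has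
the same maximal ideal and an infinite residue field (`tendsto_hilbertSamuel`). Over an infinite
residue field there is a sequence `y = y₁, …, y_d` in `𝔪` that is regular on `L`, `M` and `N` and
superficial for `L` and `M` (`exists_superficial_sequence`). Dividing by a regular superficial
element turns the Hilbert-Samuel function into its difference function in large degrees, so that
`e(M) = λ(M / yM)` and `e(L) = λ(L / yL)`.

The module `yM / y𝔪M` is an image of `(M / 𝔪M)ᵈ`, whence
`λ(M / y𝔪M) ≤ e(M) + d μ(M) = H_M(1) = λ(M / 𝔪²M)` by minimal multiplicity. As `y𝔪M ⊆ 𝔪²M`, this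
gives `𝔪²M = y𝔪M`. Since `μ(M) = μ(N)`, the submodule `L` lies in `𝔪M`, and since `y` is regular on
`N`, `L / yL` embeds into `M / yM`. Therefore `𝔪L ⊆ 𝔪²M ∩ L ⊆ yM ∩ L = yL`, so `𝔪L = yL` and
`e(L) = λ(L / yL) = λ(L / 𝔪L) = μ(L)` (`tendsto_hilbertSamuel_of_infinite`). That `L` is
Cohen-Macaulay of dimension `d` is the depth lemma, which follows from the description of depth by
the vanishing of `Ext`.

Superficial elements are found by avoiding the associated primes of the associated graded module
(`exists_finite_avoid_superficial`); the regular ones among them satisfy `𝔪ⁿ⁺¹M : y = 𝔪ⁿM` for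
large `n` by the Artin-Rees lemma (`exists_colon_le`).
-/

/-! ### Depth -/

namespace UlrichCM

open RingTheory.Sequence CategoryTheory Abelian

universe u v

/-- There is an `M`-regular sequence of length `k` in the maximal ideal, i.e. `depth M ≥ k`. -/
def HasDepth (R : Type*) [CommRing R] [IsLocalRing R] (M : Type*) [AddCommGroup M] [Module R M]
    (k : ℕ) : Prop :=
  ∃ rs : List R, rs.length = k ∧ (∀ r ∈ rs, r ∈ maximalIdeal R) ∧ IsRegular M rs

section

variable {R : Type u} [CommRing R] [IsLocalRing R]

lemma HasDepth.nontrivial {M : Type*} [AddCommGroup M] [Module R M] {k : ℕ}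
    (h : HasDepth R M k) : Nontrivial M :=
  let ⟨_, _, _, h⟩ := h
  h.nontrivial

lemma HasDepth.congr {M M' : Type*} [AddCommGroup M] [Module R M] [AddCommGroup M'] [Module R M']
    (e : M ≃ₗ[R] M') {k : ℕ} (h : HasDepth R M k) : HasDepth R M' k := by
  obtain ⟨rs, h1, h2, h3⟩ := h
  exact ⟨rs, h1, h2, (e.isRegular_congr rs).1 h3⟩

lemma HasDepth.mono {M : Type*} [AddCommGroup M] [Module R M] [Module.Finite R M] {k l : ℕ}
    (h : HasDepth R M l) (hkl : k ≤ l) : HasDepth R M k := by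
  obtain ⟨rs, rfl, h2, h3⟩ := h
  have := h3.nontrivial
  have hm : ∀ r ∈ rs.take k, r ∈ maximalIdeal R := fun r hr ↦ h2 r (List.mem_of_mem_take hr)
  have hw := h3.1
  rw [← List.take_append_drop k rs, isWeaklyRegular_append_iff] at hw
  exact ⟨rs.take k, by simpa using hkl, hm,
    IsRegular.of_isWeaklyRegular_of_mem_maximalIdeal M hm hw.1⟩

variable [IsNoetherianRing R] [Small.{v} R]

/-- The Rees characterization of depth by the vanishing of `Extⁱ(k, M)`. -/
lemma hasDepth_iff_ext (M : Type v) [AddCommGroup M] [Module R M] [Module.Finite R M]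
    [Nontrivial M] (k : ℕ) :
    HasDepth R M k ↔ ∀ i < k, Subsingleton
      (Ext (ModuleCat.of R (Shrink.{v} (R ⧸ maximalIdeal R))) (ModuleCat.of R M) i) := by
  have h : maximalIdeal R • (⊤ : Submodule R M) < ⊤ := by
    apply lt_top_iff_ne_top.2
    intro h
    exact top_ne_bot (Submodule.eq_bot_of_le_smul_of_le_jacobson_bot _ _
      (Module.finite_def.1 inferInstance) h.ge (maximalIdeal_le_jacobson _))
  exact (ModuleCat.exists_isRegular_tfae (maximalIdeal R) k (ModuleCat.of R M) h).out 3 1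

variable {L M N : Type v} [AddCommGroup L] [Module R L] [Module.Finite R L]
  [AddCommGroup M] [Module R M] [Module.Finite R M]
  [AddCommGroup N] [Module R N] [Module.Finite R N]

/-- The depth lemma for the kernel of a surjection. -/
lemma HasDepth.of_exact_left [Nontrivial L] {f : L →ₗ[R] M} {g : M →ₗ[R] N}
    (hf : Function.Injective f) (hfg : Function.Exact f g) (hg : Function.Surjective g) {k : ℕ}
    (hM : HasDepth R M k) (hN : HasDepth R N k) : HasDepth R L k := by
  have := hM.nontrivial
  have := hN.nontrivial
  rw [hasDepth_iff_ext] at *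
  have hS := ModuleCat.shortComplex_shortExact
    (ModuleCat.shortComplexOfCompEqZero f g hfg.linearMap_comp_eq_zero) hfg hf hg
  intro i hi
  cases i with
  | zero =>
    have : Mono (ModuleCat.ofHom f) := hS.mono_f
    have := hM 0 hi
    exact (Ext.postcomp_mk₀_injective_of_mono
      (ModuleCat.of R (Shrink.{v} (R ⧸ maximalIdeal R))) (ModuleCat.ofHom f)).subsingleton
  | succ i =>
    exact AddCommGrpCat.subsingleton_of_isZero <| ShortComplex.Exact.isZero_of_both_zeros
        ((Ext.covariant_sequence_exact₁' _ hS) i (i + 1) rfl)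
        ((AddCommGrpCat.isZero_of_iff_subsingleton.mpr (hN i (by omega))).eq_zero_of_src _)
        ((AddCommGrpCat.isZero_of_iff_subsingleton.mpr (hM (i+1) (by omega))).eq_zero_of_tgt _)

/-- The depth lemma for the cokernel of an injection. -/
lemma HasDepth.of_exact_right [Nontrivial N] {f : L →ₗ[R] M} {g : M →ₗ[R] N}
    (hf : Function.Injective f) (hfg : Function.Exact f g) (hg : Function.Surjective g) {k : ℕ}
    (hL : HasDepth R L (k + 1)) (hM : HasDepth R M k) : HasDepth R N k := by
  have := hM.nontrivial
  have := hL.nontrivial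
  rw [hasDepth_iff_ext] at *
  have hS := ModuleCat.shortComplex_shortExact
    (ModuleCat.shortComplexOfCompEqZero f g hfg.linearMap_comp_eq_zero) hfg hf hg
  intro i hi
  exact AddCommGrpCat.subsingleton_of_isZero <| ShortComplex.Exact.isZero_of_both_zeros
        ((Ext.covariant_sequence_exact₃' _ hS) i (i + 1) rfl)
        ((AddCommGrpCat.isZero_of_iff_subsingleton.mpr (hM i (by omega))).eq_zero_of_src _)
        ((AddCommGrpCat.isZero_of_iff_subsingleton.mpr (hL (i+1) (by omega))).eq_zero_of_tgt _)

lemma HasDepth.quotSMulTop {k : ℕ} (hM : HasDepth R M (k + 1)) {y : R}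
    (hy : IsSMulRegular M y) (hym : y ∈ maximalIdeal R) : HasDepth R (QuotSMulTop y M) k := by
  have := hM.nontrivial
  have := nontrivial_quotSMulTop_of_mem_maximalIdeal M hym
  exact HasDepth.of_exact_right (f := LinearMap.lsmul R M y) (g := Submodule.mkQ _) hy
    (LinearMap.exact_lsmul_mkQ_smul_top M y) (Submodule.mkQ_surjective _) hM
    (hM.mono (Nat.le_succ k))

end

end UlrichCM

/-! ### Superficial elements -/

namespace UlrichCM

section

variable {R : Type*} [CommRing R]

/-- The degree one part of the Rees algebra: `a ∈ I` is sent to `aT`. -/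
noncomputable def reesDegreeOne (I : Ideal R) : I →ₗ[R] reesAlgebra I :=
  LinearMap.codRestrict (Subalgebra.toSubmodule (reesAlgebra I))
    ((Polynomial.monomial 1).comp I.subtype)
    (fun a ↦ reesAlgebra.monomial_mem.mpr (by simp))

lemma coe_reesDegreeOne (I : Ideal R) (a : I) :
    (reesDegreeOne I a : Polynomial R) = Polynomial.monomial 1 (a : R) := rfl

lemma monomial_mem_span_reesDegreeOne_pow (I : Ideal R) (c : ℕ) {b : R} (hb : b ∈ I ^ c) :
    (⟨Polynomial.monomial c b, reesAlgebra.monomial_mem.mpr hb⟩ : reesAlgebra I) ∈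
      (Ideal.span (Set.range (reesDegreeOne I))) ^ c := by
  induction c generalizing b with
  | zero => simp
  | succ c ih =>
    have hb' := hb
    rw [pow_succ'] at hb'
    induction hb' using Submodule.mul_induction_on' with
    | mem_mul_mem a ha b' hb' =>
      have := Ideal.mul_mem_mul (Ideal.subset_span (Set.mem_range_self (f := reesDegreeOne I)
        ⟨a, ha⟩)) (ih hb')
      rw [← pow_succ'] at this
      convert this using 1
      apply Subtype.ext
      simp [coe_reesDegreeOne, Polynomial.monomial_mul_monomial, add_comm]
    | add x hx y hy h1 h2 =>
      rw [← pow_succ'] at hx hy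
      convert add_mem (h1 hx) (h2 hy) using 1
      apply Subtype.ext
      simp

variable {M : Type*} [AddCommGroup M] [Module R M]

/-- For `y ∈ I`, the filtration `n ↦ {u ∈ IⁿM | yu ∈ Iⁿ⁺²M}`, which measures how far the class of
`y` in degree one is from being a nonzerodivisor on the associated graded module. -/
def colonFiltration (I : Ideal R) (M : Type*) [AddCommGroup M] [Module R M] (y : R) :
    I.Filtration M where
  N n := I ^ n • ⊤ ⊓ (I ^ (n + 2) • ⊤ : Submodule R M).comap (LinearMap.lsmul R M y)
  mono n := inf_le_inf (Submodule.smul_mono_left (Ideal.pow_le_pow_right (Nat.le_succ _)))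
    (Submodule.comap_mono (Submodule.smul_mono_left (Ideal.pow_le_pow_right (by omega))))
  smul_le n := by
    rw [Submodule.smul_le]
    rintro r hr u ⟨h1, h2⟩
    refine ⟨?_, ?_⟩
    · rw [pow_succ', Submodule.mul_smul]
      exact Submodule.smul_mem_smul hr h1
    · change LinearMap.lsmul R M y (r • u) ∈ (I ^ (n + 2 + 1) • ⊤ : Submodule R M)
      rw [map_smul, pow_succ', Submodule.mul_smul]
      exact Submodule.smul_mem_smul hr h2

/-- Superficial elements can be found by avoiding finitely many ideals, none of which contains `I`:
these are the degree one parts of the associated primes of the associated graded module that do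
not contain the whole degree one part of the Rees algebra. -/
lemma exists_finite_avoid_superficial [IsNoetherianRing R] [Module.Finite R M] (I : Ideal R) :
    ∃ 𝒱 : Set (Ideal R), 𝒱.Finite ∧ (∀ V ∈ 𝒱, ¬ I ≤ V) ∧ ∀ y ∈ I, (∀ V ∈ 𝒱, y ∉ V) →
      ∃ n₀, ∀ n ≥ n₀, ∀ u ∈ (I ^ n • ⊤ : Submodule R M), y • u ∈ (I ^ (n + 2) • ⊤ : Submodule R M) →
        u ∈ (I ^ (n + 1) • ⊤ : Submodule R M) := by
  let F : I.Filtration M := I.stableFiltration ⊤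
  let F' : I.Filtration M := I.stableFiltration (I • ⊤)
  let Q := F.submodule.map F'.submodule.mkQ
  have hF : F.submodule.FG := (F.submodule_fg_iff_stable fun _ ↦ IsNoetherian.noetherian _).2
    (I.stableFiltration_stable ⊤)
  have : IsNoetherian (reesAlgebra I) Q := isNoetherian_of_fg_of_noetherian _ (hF.map _)
  -- `Q` is the associated graded module, and `V P` is the degree one part of `P`.
  let V : Ideal (reesAlgebra I) → Ideal R := fun P ↦
    ((P.restrictScalars R).comap (reesDegreeOne I)).map I.subtype
  refine ⟨V '' associatedPrimes (reesAlgebra I) Q ∩ {V | ¬ I ≤ V},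
    ((associatedPrimes.finite _ _).image V).inter_of_left _, fun V h ↦ h.2, fun y hy hV ↦ ?_⟩
  let K := colonFiltration I M y
  have hKF : K ≤ F := fun n ↦ inf_le_left
  have hKs : K.Stable := (I.stableFiltration_stable ⊤).of_le hKF
  have hKsub : K.submodule ≤ F.submodule := fun x hx n ↦ hKF n (hx n)
  let KQ := K.submodule.map F'.submodule.mkQ
  have hKQ : KQ ≤ Q := Submodule.map_mono hKsub
  have : IsNoetherian (reesAlgebra I) KQ := isNoetherian_of_le hKQ
  have hann : reesDegreeOne I ⟨y, hy⟩ ∈ Module.annihilator (reesAlgebra I) KQ := by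
    rw [Module.mem_annihilator]
    rintro ⟨_, x, hx, rfl⟩
    apply Subtype.ext
    change _ • F'.submodule.mkQ x = 0
    rw [← map_smul, Submodule.mkQ_apply, Submodule.Quotient.mk_eq_zero]
    intro n
    rw [Subalgebra.smul_def, coe_reesDegreeOne]
    rw [PolynomialModule.monomial_smul_apply]
    split_ifs with h
    · obtain ⟨m, rfl⟩ := Nat.exists_eq_add_of_le' h
      have h1 : y • x.coeff m ∈ (I ^ (m + 2) • ⊤ : Submodule R M) := (hx m).2
      change _ ∈ I ^ (m + 1) • I • (⊤ : Submodule R M)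
      rwa [← Submodule.mul_smul, ← pow_succ, Nat.add_sub_cancel]
    · exact zero_mem _
  have hrad : Ideal.span (Set.range (reesDegreeOne I)) ≤
      (Module.annihilator (reesAlgebra I) KQ).radical := by
    rw [Ideal.span_le]
    rintro _ ⟨a, rfl⟩
    rw [SetLike.mem_coe, ← Ideal.sInf_minimalPrimes, Ideal.mem_sInf]
    intro P hP
    have hPQ : P ∈ associatedPrimes (reesAlgebra I) Q :=
      associatedPrimes.subset_of_injective (f := Submodule.inclusion hKQ)
        (Submodule.inclusion_injective hKQ)
        (Module.associatedPrimes.minimalPrimes_annihilator_subset_associatedPrimes _ _ hP)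
    have hyP : reesDegreeOne I ⟨y, hy⟩ ∈ P := hP.1.2 hann
    by_contra haP
    refine hV (V P) ⟨⟨P, hPQ, rfl⟩, fun hle ↦ haP ?_⟩ ⟨⟨y, hy⟩, hyP, rfl⟩
    obtain ⟨b, hb, hba⟩ := hle a.2
    obtain rfl : b = a := Subtype.ext hba
    exact hb
  obtain ⟨c, hc⟩ := Ideal.exists_pow_le_of_le_radical_of_fg hrad (IsNoetherian.noetherian _)
  -- The kernel of `yT` on `Q` is killed by a power of the irrelevant ideal; it vanishes in large
  -- degrees because the filtration `K` is stable.
  have key : ∀ n, I ^ c • K.N n ≤ F'.N (c + n) := by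
    intro n
    rw [Submodule.smul_le]
    intro b hb u hu
    have h1 := Module.mem_annihilator.1 (hc (monomial_mem_span_reesDegreeOne_pow I c hb))
      ⟨F'.submodule.mkQ (PolynomialModule.single R n u), PolynomialModule.single R n u, fun i ↦ by
        rw [PolynomialModule.coeff_single, Finsupp.single_apply]
        split_ifs with h
        · exact h ▸ hu
        · exact zero_mem _, rfl⟩
    have h2 : F'.submodule.mkQ ((⟨Polynomial.monomial c b, reesAlgebra.monomial_mem.mpr hb⟩ :
      reesAlgebra I) • PolynomialModule.single R n u) = 0 := by
      rw [map_smul]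
      exact congrArg Subtype.val h1
    rw [Submodule.mkQ_apply, Submodule.Quotient.mk_eq_zero] at h2
    have h3 := h2 (c + n)
    rw [Subalgebra.smul_def] at h3
    rw [PolynomialModule.monomial_smul_single, PolynomialModule.coeff_single,
      Finsupp.single_eq_same] at h3
    exact h3
  obtain ⟨n₀, hn₀⟩ := hKs.exists_pow_smul_eq
  refine ⟨n₀ + c, fun n hn u hu hyu ↦ ?_⟩
  obtain ⟨k, rfl⟩ := Nat.exists_eq_add_of_le hn
  have hu : u ∈ K.N (n₀ + (c + k)) := by
    rw [← add_assoc]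
    exact ⟨hu, hyu⟩
  rw [hn₀, pow_add, Submodule.mul_smul, ← hn₀] at hu
  have := key _ hu
  change u ∈ I ^ _ • I • ⊤ at this
  rw [← Submodule.mul_smul, ← pow_succ] at this
  convert this using 3
  omega

/-- If multiplication by a regular element `y ∈ I` is injective in large degrees on the associated
graded module, then `Iⁿ⁺¹M : y = IⁿM` for large `n`, by the Artin-Rees lemma. -/
lemma exists_colon_le [IsNoetherianRing R] [Module.Finite R M] (I : Ideal R) {y : R}
    (hy : IsSMulRegular M y)
    (h : ∃ n₀, ∀ n ≥ n₀, ∀ u ∈ (I ^ n • ⊤ : Submodule R M),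
      y • u ∈ (I ^ (n + 2) • ⊤ : Submodule R M) → u ∈ (I ^ (n + 1) • ⊤ : Submodule R M)) :
    ∃ n₀, ∀ n ≥ n₀, ∀ u : M, y • u ∈ (I ^ (n + 1) • ⊤ : Submodule R M) →
      u ∈ (I ^ n • ⊤ : Submodule R M) := by
  obtain ⟨n₀, h⟩ := h
  obtain ⟨k, hk⟩ := I.exists_pow_inf_eq_pow_smul (LinearMap.range (LinearMap.lsmul R M y))
  refine ⟨n₀ + k, fun n hn u hu ↦ ?_⟩
  have h1 : u ∈ (I ^ (n + 1 - k) • ⊤ : Submodule R M) := by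
    have h2 : y • u ∈ I ^ (n + 1) • ⊤ ⊓ LinearMap.range (LinearMap.lsmul R M y) := ⟨hu, u, rfl⟩
    rw [hk _ (by omega)] at h2
    replace h2 := Submodule.smul_mono le_rfl inf_le_right h2
    rw [LinearMap.range_eq_map, ← Submodule.map_smul''] at h2
    obtain ⟨w, hw, hwu⟩ := h2
    rwa [← hy hwu]
  -- By Artin-Rees `u` lies in a power of bounded defect, and the hypothesis raises the exponent.
  have h2 : ∀ j, n₀ ≤ j → j ≤ n → u ∈ (I ^ j • ⊤ : Submodule R M) := by
    intro j hj
    induction j, hj using Nat.le_induction with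
    | base =>
      intro _
      exact Submodule.smul_mono_left (Ideal.pow_le_pow_right (by omega)) h1
    | succ j hj ih =>
      intro hjn
      exact h j hj u (ih (by omega))
        (Submodule.smul_mono_left (Ideal.pow_le_pow_right (by omega)) hu)
  exact h2 n (by omega) le_rfl

end

section

variable {R : Type*} [CommRing R] [IsLocalRing R] [IsNoetherianRing R]

/-- Over an infinite residue field the maximal ideal is not covered by finitely many ideals that do
not contain it. -/
lemma exists_mem_maximalIdeal_forall_notMem [Infinite (ResidueField R)] {𝒱 : Set (Ideal R)}
    (hf : 𝒱.Finite) (h𝒱 : ∀ V ∈ 𝒱, ¬ maximalIdeal R ≤ V) :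
    ∃ y ∈ maximalIdeal R, ∀ V ∈ 𝒱, y ∉ V := by
  classical
  let W₀ : Ideal R → Submodule R (CotangentSpace R) := fun V ↦
    (Submodule.comap (maximalIdeal R).subtype V).map (maximalIdeal R).toCotangent
  let W : Ideal R → Subspace (ResidueField R) (CotangentSpace R) := fun V ↦
    { W₀ V with
      smul_mem' := fun c x hx ↦ by
        obtain ⟨c, rfl⟩ := residue_surjective c
        exact (W₀ V).smul_mem c hx }
  -- The images in the cotangent space are proper subspaces by Nakayama's lemma.
  have htop : (⊤ : Subspace (ResidueField R) (CotangentSpace R)) ∉ hf.toFinset.image W := by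
    rw [Finset.mem_image]
    rintro ⟨V, hV, hVt⟩
    rw [Set.Finite.mem_toFinset] at hV
    refine h𝒱 V hV (Submodule.le_of_le_smul_of_le_jacobson_bot (I := maximalIdeal R)
      (IsNoetherian.noetherian _) (maximalIdeal_le_jacobson _) fun a ha ↦ ?_)
    have : (maximalIdeal R).toCotangent ⟨a, ha⟩ ∈ W₀ V :=
      show _ ∈ W V from hVt ▸ Submodule.mem_top
    obtain ⟨b, hb, hba⟩ := this
    rw [Ideal.toCotangent_eq] at hba
    have h3 : a = b + (a - b) := by ring
    rw [h3]
    refine Submodule.add_mem_sup hb ?_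
    rw [smul_eq_mul, ← sq, ← neg_sub]
    exact neg_mem hba
  have hne := Subspace.biUnion_ne_univ_of_top_notMem htop
  obtain ⟨x, hx⟩ := (Set.ne_univ_iff_exists_notMem _).1 hne
  obtain ⟨⟨y, hy⟩, rfl⟩ := (maximalIdeal R).toCotangent_surjective x
  refine ⟨y, hy, fun V hV hyV ↦ hx ?_⟩
  simp only [Set.mem_iUnion]
  have hyW : (maximalIdeal R).toCotangent ⟨y, hy⟩ ∈ W₀ V := ⟨⟨y, hy⟩, hyV, rfl⟩
  exact ⟨W V, Finset.mem_image_of_mem _ (hf.mem_toFinset.2 hV), hyW⟩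

variable {M : Type*} [AddCommGroup M] [Module R M]

lemma HasDepth.not_le_of_mem_associatedPrimes {k : ℕ} (hM : HasDepth R M (k + 1)) {P : Ideal R}
    (hP : P ∈ associatedPrimes R M) : ¬ maximalIdeal R ≤ P := by
  intro hle
  obtain ⟨rs, h1, h2, h3⟩ := hM
  obtain _ | ⟨r, rs⟩ := rs
  · simp at h1
  have hr := ((RingTheory.Sequence.isRegular_cons_iff M r rs).1 h3).1
  have h4 : r ∈ ⋃ p ∈ associatedPrimes R M, (p : Set R) :=
    Set.mem_biUnion hP (hle (h2 r (by simp)))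
  rw [biUnion_associatedPrimes_eq_compl_regular] at h4
  exact h4 hr

lemma isSMulRegular_of_forall_notMem {R : Type*} [CommRing R] [IsNoetherianRing R] {M : Type*}
    [AddCommGroup M] [Module R M] {y : R} (h : ∀ P ∈ associatedPrimes R M, y ∉ P) :
    IsSMulRegular M y := by
  by_contra hy
  have : y ∈ ({r | IsSMulRegular M r} : Set R)ᶜ := hy
  rw [← biUnion_associatedPrimes_eq_compl_regular] at this
  obtain ⟨P, hP, hyP⟩ := Set.mem_iUnion₂.1 this
  exact h P hP hyP

end

end UlrichCM

/-! ### Hilbert-Samuel functions and their leading coefficients -/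

namespace UlrichCM

section

open scoped Pointwise

variable {R : Type*} [CommRing R] [IsLocalRing R] {M : Type*} [AddCommGroup M] [Module R M]

lemma hilbertSamuel_congr {M' : Type*} [AddCommGroup M'] [Module R M'] (e : M ≃ₗ[R] M') (n : ℕ) :
    hilbertSamuel R M n = hilbertSamuel R M' n := by
  unfold hilbertSamuel
  rw [(Submodule.Quotient.equiv (maximalIdeal R ^ (n + 1) • ⊤ : Submodule R M)
    (maximalIdeal R ^ (n + 1) • ⊤ : Submodule R M') e (by
      rw [Submodule.map_smul'', Submodule.map_top, LinearEquiv.range])).length_eq]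

variable [Module.Finite R M]

lemma length_quotient_maximalIdeal_smul :
    Module.length R (M ⧸ (maximalIdeal R • ⊤ : Submodule R M)) =
      Module.finrank (R ⧸ maximalIdeal R) (M ⧸ (maximalIdeal R • ⊤ : Submodule R M)) := by
  let _ : Field (R ⧸ maximalIdeal R) := Ideal.Quotient.field _
  have : Module.Finite (R ⧸ maximalIdeal R) (M ⧸ (maximalIdeal R • ⊤ : Submodule R M)) :=
    Module.Finite.of_restrictScalars_finite R _ _
  rw [← Module.length_eq_finrank (R ⧸ maximalIdeal R)]
  exact Module.length_eq_of_surjective Ideal.Quotient.mk_surjective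

variable [IsNoetherianRing R]

lemma length_ne_top_of_pow_smul_eq_bot {c : ℕ}
    (h : (maximalIdeal R ^ c • ⊤ : Submodule R M) = ⊥) : Module.length R M ≠ ⊤ := by
  induction c generalizing M with
  | zero =>
    have : Subsingleton M := by
      rw [pow_zero, Ideal.one_eq_top, Submodule.top_smul] at h
      exact (Submodule.subsingleton_iff R).1 (subsingleton_of_bot_eq_top h.symm)
    simp [Module.length_eq_zero]
  | succ c ih =>
    let P : Submodule R M := maximalIdeal R • ⊤
    rw [Module.length_eq_add_of_exact P.subtype P.mkQ P.injective_subtype P.mkQ_surjective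
      (LinearMap.exact_subtype_mkQ P), length_quotient_maximalIdeal_smul]
    refine WithTop.add_ne_top.2 ⟨ih ?_, ENat.natCast_ne_top _⟩
    apply Submodule.map_injective_of_injective P.injective_subtype
    rw [Submodule.map_smul'', Submodule.map_top, Submodule.range_subtype, Submodule.map_bot,
      ← Submodule.mul_smul, ← pow_succ, h]

lemma length_quotient_ne_top {P : Submodule R M} {c : ℕ}
    (h : (maximalIdeal R ^ c • ⊤ : Submodule R M) ≤ P) : Module.length R (M ⧸ P) ≠ ⊤ := by
  apply length_ne_top_of_pow_smul_eq_bot (c := c)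
  rw [← Submodule.range_mkQ, ← Submodule.map_top, ← Submodule.map_smul'', eq_bot_iff,
    Submodule.map_le_iff_le_comap, Submodule.comap_bot, Submodule.ker_mkQ]
  exact h

lemma coe_hilbertSamuel (n : ℕ) : (hilbertSamuel R M n : ℕ∞) =
    Module.length R (M ⧸ (maximalIdeal R ^ (n + 1) • ⊤ : Submodule R M)) :=
  ENat.natCast_toNat (length_quotient_ne_top le_rfl)

lemma exists_pow_smul_eq_bot_of_supportDim_le_zero (h : Module.supportDim R M ≤ 0) :
    ∃ c, (maximalIdeal R ^ c • ⊤ : Submodule R M) = ⊥ := by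
  rcases subsingleton_or_nontrivial M with hM | hM
  · exact ⟨0, Subsingleton.elim _ _⟩
  have h0 : Module.supportDim R M = 0 := by
    refine le_antisymm h ?_
    have := Module.supportDim_ne_bot_of_nontrivial (R := R) (M := M)
    obtain ⟨x, hx⟩ := WithBot.ne_bot_iff_exists.1 this
    rw [← hx]
    exact_mod_cast zero_le
  have h1 := support_of_supportDim_eq_zero R M h0
  rw [Module.support_eq_zeroLocus, PrimeSpectrum.zeroLocus_eq_iff] at h1
  have h2 : maximalIdeal R ≤ (Module.annihilator R M).radical := h1 ▸ Ideal.le_radical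
  obtain ⟨c, hc⟩ := Ideal.exists_pow_le_of_le_radical_of_fg h2 (IsNoetherian.noetherian _)
  refine ⟨c, ?_⟩
  rw [eq_bot_iff, Submodule.smul_le]
  intro r hr u _
  rw [Module.mem_annihilator.1 (hc hr) u]
  exact zero_mem _

/-- If `mⁿ⁺¹M : y = mⁿM`, the Hilbert-Samuel function of `M / yM` is the difference of that
of `M`. -/
lemma hilbertSamuel_succ_of_colon_le {y : R} (hy : y ∈ maximalIdeal R) {n : ℕ}
    (h : ∀ u : M, y • u ∈ (maximalIdeal R ^ (n + 2) • ⊤ : Submodule R M) →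
      u ∈ (maximalIdeal R ^ (n + 1) • ⊤ : Submodule R M)) :
    hilbertSamuel R M (n + 1) = hilbertSamuel R M n +
      hilbertSamuel R (QuotSMulTop y M) (n + 1) := by
  have h1 : (maximalIdeal R ^ (n + 1) • ⊤ : Submodule R M) =
      (maximalIdeal R ^ (n + 2) • ⊤ : Submodule R M).comap (LinearMap.lsmul R M y) := by
    refine le_antisymm (fun u hu ↦ ?_) h
    rw [Submodule.mem_comap, LinearMap.lsmul_apply, pow_succ', Submodule.mul_smul]
    exact Submodule.smul_mem_smul hy hu
  let π := (y • ⊤ : Submodule R M).mkQ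
  have h2 : (maximalIdeal R ^ (n + 2) • ⊤ : Submodule R (QuotSMulTop y M)) =
      (maximalIdeal R ^ (n + 2) • ⊤ : Submodule R M).map π := by
    rw [Submodule.map_smul'', Submodule.map_top, Submodule.range_mkQ]
  have := Module.length_eq_add_of_exact
    (Submodule.mapQ (maximalIdeal R ^ (n + 1) • ⊤) (maximalIdeal R ^ (n + 2) • ⊤)
      (LinearMap.lsmul R M y) h1.le)
    (Submodule.mapQ (maximalIdeal R ^ (n + 2) • ⊤)
      (maximalIdeal R ^ (n + 2) • ⊤ : Submodule R (QuotSMulTop y M)) π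
      (h2 ▸ Submodule.le_comap_map _ _)) ?_ ?_ ?_
  · rw [← coe_hilbertSamuel, ← coe_hilbertSamuel, ← coe_hilbertSamuel] at this
    exact_mod_cast this
  · rw [← LinearMap.ker_eq_bot]
    exact Submodule.ker_liftQ_eq_bot _ _ _ (by
      rw [LinearMap.ker_comp, Submodule.ker_mkQ, h1])
  · apply Function.Surjective.of_comp (g := (maximalIdeal R ^ (n + 2) • ⊤ : Submodule R M).mkQ)
    exact (Submodule.mkQ_surjective _).comp (Submodule.mkQ_surjective _)
  · have hex : Function.Exact (LinearMap.lsmul R M y) π := by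
      intro x
      simp [π, Submodule.mem_smul_pointwise_iff_exists]
    rw [hex.exact_mapQ_iff, h2]
    exact inf_le_right

end

section

/-- The leading behaviour of a Hilbert-Samuel function: `H(n) = ℓ * C(n + d, d) + o(n ^ d)`. -/
def HasLeadingCoeff (H : ℕ → ℕ) (d ℓ : ℕ) : Prop :=
  (fun n ↦ (H n : ℝ) - ℓ * ((n + d).choose d : ℝ)) =o[atTop] fun n ↦ ((n + d).choose d : ℝ)

lemma tendsto_choose_add_succ_atTop (d : ℕ) :
    Tendsto (fun n ↦ ((n + (d + 1)).choose (d + 1) : ℝ)) atTop atTop := by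
  apply tendsto_natCast_atTop_atTop.comp
  refine tendsto_atTop_mono (fun n ↦ ?_) tendsto_id
  induction n with
  | zero => exact Nat.zero_le _
  | succ n ih =>
    rw [show n + 1 + (d + 1) = (n + (d + 1)) + 1 by ring, Nat.choose_succ_succ']
    have : 0 < (n + (d + 1)).choose d := Nat.choose_pos (by omega)
    simp only [id] at *
    omega

lemma sum_range_choose_add (d n : ℕ) :
    ∑ i ∈ Finset.range n, (i + 1 + d).choose d + 1 = (n + (d + 1)).choose (d + 1) := by
  induction n with
  | zero => simp
  | succ n ih =>
    rw [Finset.sum_range_succ, show n + 1 + (d + 1) = (n + (d + 1)) + 1 by ring,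
      Nat.choose_succ_succ', ← ih, show n + (d + 1) = n + 1 + d by ring]
    ring

lemma HasLeadingCoeff.of_eventually_const {H : ℕ → ℕ} {ℓ : ℕ} (h : ∀ᶠ n in atTop, H n = ℓ) :
    HasLeadingCoeff H 0 ℓ := by
  refine (Asymptotics.isLittleO_zero _ _).congr' ?_ EventuallyEq.rfl
  filter_upwards [h] with n hn
  simp [hn]

lemma HasLeadingCoeff.of_difference {H H₁ : ℕ → ℕ} {d ℓ : ℕ} (h₁ : HasLeadingCoeff H₁ d ℓ)
    (h : ∀ᶠ n in atTop, H (n + 1) = H n + H₁ (n + 1)) : HasLeadingCoeff H (d + 1) ℓ := by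
  have hS : ∀ n, ∑ i ∈ Finset.range n, ((i + 1 + d).choose d : ℝ) =
      ((n + (d + 1)).choose (d + 1) : ℝ) - 1 := fun n ↦ by
    rw [← sum_range_choose_add]
    push_cast
    ring
  -- The difference of `H` and its main term is a sum of terms that are `o(iᵈ)`.
  have h0 : (fun i ↦ ((H (i + 1) : ℝ) - H i) - ℓ * ((i + 1 + d).choose d : ℝ)) =o[atTop]
      fun i ↦ ((i + 1 + d).choose d : ℝ) := by
    refine (h₁.comp_tendsto (tendsto_add_atTop_nat 1)).congr' ?_ EventuallyEq.rfl
    filter_upwards [h] with n hn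
    simp [hn]
  have h1 := h0.sum_range (fun i ↦ Nat.cast_nonneg _) (by
    simp_rw [hS]
    exact tendsto_atTop_add_const_right _ _ (tendsto_choose_add_succ_atTop d))
  replace h1 := h1.congr (f₂ := fun n ↦ ((H n : ℝ) - H 0) -
      ℓ * (((n + (d + 1)).choose (d + 1) : ℝ) - 1))
    (g₂ := fun n ↦ ((n + (d + 1)).choose (d + 1) : ℝ) - 1)
    (fun n ↦ by rw [Finset.sum_sub_distrib, ← Finset.mul_sum, hS,
      Finset.sum_range_sub (fun i ↦ (H i : ℝ))]) hS
  have hc : ∀ c : ℝ, (fun _ : ℕ ↦ c) =o[atTop] fun n ↦ ((n + (d + 1)).choose (d + 1) : ℝ) :=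
    fun c ↦ Asymptotics.isLittleO_const_left.2
      (Or.inr (tendsto_norm_atTop_atTop.comp (tendsto_choose_add_succ_atTop d)))
  have h2 := h1.trans_isBigO ((Asymptotics.isBigO_refl _ _).sub (hc 1).isBigO)
  refine (h2.add (hc (H 0 - ℓ))).congr_left fun n ↦ ?_
  ring

lemma tendsto_factorial_div_pow_mul_choose (d : ℕ) :
    Tendsto (fun n : ℕ ↦ (d.factorial : ℝ) / (n : ℝ) ^ d * ((n + d).choose d : ℝ)) atTop (𝓝 1) := by
  have h1 : Tendsto (fun n : ℕ ↦ (((n + d : ℕ).choose d : ℝ) /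
      (((n + d : ℕ) : ℝ) ^ d / d.factorial))) atTop (𝓝 1) := by
    have := (Asymptotics.isEquivalent_iff_tendsto_one ?_).1 (isEquivalent_choose d)
    · exact this.comp (tendsto_add_atTop_nat d)
    · filter_upwards [eventually_gt_atTop 0] with n hn
      positivity
  have h2 : Tendsto (fun n : ℕ ↦ (((n : ℝ) / (n + d)) ^ d)⁻¹) atTop (𝓝 1) := by
    have := ((tendsto_natCast_div_add_atTop (d : ℝ)).pow d).inv₀
      (by rw [one_pow]; exact one_ne_zero)
    rwa [one_pow, inv_one] at this
  rw [← one_mul (1 : ℝ)]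
  refine (h1.mul h2).congr' ?_
  filter_upwards [eventually_gt_atTop 0] with n hn
  have : (n : ℝ) ≠ 0 := by positivity
  have : (n + d : ℝ) ≠ 0 := by positivity
  push_cast
  rw [div_pow]
  field_simp

lemma HasLeadingCoeff.tendsto {H : ℕ → ℕ} {d ℓ : ℕ} (h : HasLeadingCoeff H d ℓ) :
    Tendsto (fun n : ℕ ↦ (d.factorial : ℝ) / (n : ℝ) ^ d * H n) atTop (𝓝 ℓ) := by
  have h1 : Tendsto (fun n ↦ ((H n : ℝ) - ℓ * ((n + d).choose d : ℝ)) / ((n + d).choose d : ℝ))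
    atTop (𝓝 0) := h.tendsto_div_nhds_zero
  have h2 := (tendsto_factorial_div_pow_mul_choose d).mul (h1.add_const (ℓ : ℝ))
  rw [zero_add, one_mul] at h2
  refine h2.congr fun n ↦ ?_
  have : ((n + d).choose d : ℝ) ≠ 0 := by
    exact_mod_cast (Nat.choose_pos (by omega)).ne'
  field_simp
  ring

end

end UlrichCM

/-! ### Infinite residue fields -/

namespace UlrichCM

open RingTheory.Sequence

section

variable {R : Type*} [CommRing R] {M : Type*} [AddCommGroup M] [Module R M]

lemma length_quotient_quotient_add {A B : Submodule R M} (h : A ≤ B) :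
    Module.length R (M ⧸ A) = Module.length R (B.map A.mkQ) + Module.length R (M ⧸ B) := by
  rw [Module.length_eq_add_of_exact (B.map A.mkQ).subtype (B.map A.mkQ).mkQ
    (Submodule.injective_subtype _) (Submodule.mkQ_surjective _) (LinearMap.exact_subtype_mkQ _),
    (Submodule.quotientQuotientEquivQuotient A B h).length_eq]

lemma eq_of_le_of_length_quotient_le {A B : Submodule R M} (h : A ≤ B)
    (hl : Module.length R (M ⧸ A) ≤ Module.length R (M ⧸ B))
    (hB : Module.length R (M ⧸ B) ≠ ⊤) : A = B := by
  refine le_antisymm h ?_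
  rw [length_quotient_quotient_add h] at hl
  have h0 : Module.length R (B.map A.mkQ) = 0 := by
    generalize Module.length R (B.map A.mkQ) = a at hl
    lift Module.length R (M ⧸ B) to ℕ using hB with b
    have ha : a ≠ ⊤ := by
      rintro rfl
      simp at hl
    lift a to ℕ using ha
    norm_cast at hl ⊢
    omega
  rw [Module.length_eq_zero_iff, Submodule.subsingleton_iff_eq_bot, ← LinearMap.le_ker_iff_map,
    Submodule.ker_mkQ] at h0
  exact h0

/-- If `J` is generated by `d` elements, `JM / JP` is an image of `(M / P)ᵈ`. -/
lemma length_quotient_ofList_smul_le (rs : List R) (P : Submodule R M) :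
    Module.length R (M ⧸ Ideal.ofList rs • P) ≤
      Module.length R (M ⧸ (Ideal.ofList rs • ⊤ : Submodule R M)) +
        rs.length * Module.length R (M ⧸ P) := by
  have hmem : ∀ i : Fin rs.length, rs[i] ∈ Ideal.ofList rs := fun i ↦
    Ideal.subset_span (List.getElem_mem _)
  let ψ : Fin rs.length → (M ⧸ P →ₗ[R] M ⧸ Ideal.ofList rs • P) := fun i ↦
    Submodule.mapQ P (Ideal.ofList rs • P) (LinearMap.lsmul R M rs[i])
      fun u hu ↦ Submodule.smul_mem_smul (hmem i) hu
  let φ : (Fin rs.length → M ⧸ P) →ₗ[R] M ⧸ Ideal.ofList rs • P :=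
    ∑ i, (ψ i).comp (LinearMap.proj i)
  have hφ : ∀ i (u : M), φ (Pi.single i (Submodule.Quotient.mk u)) =
      Submodule.Quotient.mk (rs[i] • u) := fun i u ↦ by
    rw [LinearMap.sum_apply, Finset.sum_eq_single i]
    · simp [ψ]
    · intro j _ hj
      simp [hj]
    · simp
  have hle : (Ideal.ofList rs • ⊤ : Submodule R M).map (Ideal.ofList rs • P).mkQ ≤
      LinearMap.range φ := by
    rw [Submodule.map_le_iff_le_comap, Submodule.smul_le]
    intro r hr
    induction hr using Submodule.span_induction with
    | mem r hr =>
      intro u _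
      obtain ⟨i, hi, rfl⟩ := List.mem_iff_getElem.1 hr
      exact ⟨_, hφ ⟨i, hi⟩ u⟩
    | zero => simp
    | add x y _ _ hx hy =>
      intro u hu
      rw [add_smul]
      exact add_mem (hx u hu) (hy u hu)
    | smul a x _ hx =>
      intro u hu
      rw [smul_assoc]
      exact Submodule.smul_mem _ _ (hx u hu)
  rw [length_quotient_quotient_add (Submodule.smul_mono le_rfl le_top), add_comm]
  gcongr
  calc _ ≤ Module.length R (LinearMap.range φ) :=
        Module.length_le_of_injective (Submodule.inclusion hle) (Submodule.inclusion_injective hle)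
    _ ≤ Module.length R (Fin rs.length → M ⧸ P) :=
        Module.length_le_of_surjective φ.rangeRestrict φ.surjective_rangeRestrict
    _ = _ := by simp [Module.length_pi_of_fintype]

end

section

universe u v

variable {R : Type u} [CommRing R] [IsLocalRing R] [IsNoetherianRing R]

/-- Over an infinite residue field there is an element of the maximal ideal that is regular on two
modules of positive depth and superficial on two further modules. -/
lemma exists_regular_superficial [Infinite (ResidueField R)] {A B C D : Type*}
    [AddCommGroup A] [Module R A] [Module.Finite R A] [AddCommGroup B] [Module R B]
    [Module.Finite R B] [AddCommGroup C] [Module R C] [Module.Finite R C]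
    [AddCommGroup D] [Module R D] [Module.Finite R D] {k : ℕ}
    (hA : HasDepth R A (k + 1)) (hB : HasDepth R B (k + 1)) :
    ∃ y ∈ maximalIdeal R, IsSMulRegular A y ∧ IsSMulRegular B y ∧
      (∃ n₀, ∀ n ≥ n₀, ∀ u ∈ (maximalIdeal R ^ n • ⊤ : Submodule R C),
        y • u ∈ (maximalIdeal R ^ (n + 2) • ⊤ : Submodule R C) →
        u ∈ (maximalIdeal R ^ (n + 1) • ⊤ : Submodule R C)) ∧
      (∃ n₀, ∀ n ≥ n₀, ∀ u ∈ (maximalIdeal R ^ n • ⊤ : Submodule R D),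
        y • u ∈ (maximalIdeal R ^ (n + 2) • ⊤ : Submodule R D) →
        u ∈ (maximalIdeal R ^ (n + 1) • ⊤ : Submodule R D)) := by
  obtain ⟨𝒱, h1, h2, h3⟩ := exists_finite_avoid_superficial (M := C) (maximalIdeal R)
  obtain ⟨𝒲, h1', h2', h3'⟩ := exists_finite_avoid_superficial (M := D) (maximalIdeal R)
  obtain ⟨y, hy, hav⟩ := exists_mem_maximalIdeal_forall_notMem
    (((associatedPrimes.finite R A).union (associatedPrimes.finite R B)).union (h1.union h1')) (by
      rintro V ((hV | hV) | (hV | hV))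
      · exact hA.not_le_of_mem_associatedPrimes hV
      · exact hB.not_le_of_mem_associatedPrimes hV
      · exact h2 V hV
      · exact h2' V hV)
  exact ⟨y, hy, isSMulRegular_of_forall_notMem fun P hP ↦ hav P (Or.inl (Or.inl hP)),
    isSMulRegular_of_forall_notMem fun P hP ↦ hav P (Or.inl (Or.inr hP)),
    h3 y hy fun V hV ↦ hav V (Or.inr (Or.inl hV)),
    h3' y hy fun V hV ↦ hav V (Or.inr (Or.inr hV))⟩

/-- Passing to the quotient by a regular superficial element preserves the multiplicity. -/
lemma HasLeadingCoeff.of_quotSMulTop {M : Type*} [AddCommGroup M] [Module R M] [Module.Finite R M]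
    {y : R} (hy : y ∈ maximalIdeal R) (hreg : IsSMulRegular M y)
    (h : ∃ n₀, ∀ n ≥ n₀, ∀ u ∈ (maximalIdeal R ^ n • ⊤ : Submodule R M),
      y • u ∈ (maximalIdeal R ^ (n + 2) • ⊤ : Submodule R M) →
      u ∈ (maximalIdeal R ^ (n + 1) • ⊤ : Submodule R M)) {d ℓ : ℕ}
    (hd : HasLeadingCoeff (hilbertSamuel R (QuotSMulTop y M)) d ℓ) :
    HasLeadingCoeff (hilbertSamuel R M) (d + 1) ℓ := by
  obtain ⟨n₀, hn₀⟩ := exists_colon_le _ hreg h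
  refine hd.of_difference ?_
  filter_upwards [eventually_ge_atTop n₀] with n hn
  exact hilbertSamuel_succ_of_colon_le hy (hn₀ (n + 1) (by omega))

lemma hasLeadingCoeff_of_pow_smul_eq_bot {R : Type*} [CommRing R] [IsLocalRing R]
    {M : Type*} [AddCommGroup M] [Module R M] {c : ℕ}
    (h : (maximalIdeal R ^ c • ⊤ : Submodule R M) = ⊥) :
    HasLeadingCoeff (hilbertSamuel R M) 0 (Module.length R M).toNat := by
  apply HasLeadingCoeff.of_eventually_const
  filter_upwards [eventually_ge_atTop c] with n hn
  have : (maximalIdeal R ^ (n + 1) • ⊤ : Submodule R M) = ⊥ := by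
    rw [eq_bot_iff, ← h]
    exact Submodule.smul_mono_left (Ideal.pow_le_pow_right (by omega))
  unfold hilbertSamuel
  rw [(Submodule.quotEquivOfEqBot _ this).length_eq]

/-- A superficial sequence for `L` and `M` that is regular on `N`. -/
lemma exists_superficial_sequence [Small.{v} R] [Infinite (ResidueField R)] (d : ℕ)
    {L M N : Type v} [AddCommGroup L] [Module R L] [Module.Finite R L]
    [AddCommGroup M] [Module R M] [Module.Finite R M]
    [AddCommGroup N] [Module R N] [Module.Finite R N]
    {f : L →ₗ[R] M} {g : M →ₗ[R] N} (hf : Function.Injective f)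
    (hfg : Function.Exact f g) (hg : Function.Surjective g)
    (hM : HasDepth R M d) (hN : HasDepth R N d) (hdim : Module.supportDim R M ≤ d) :
    ∃ rs : List R, rs.length = d ∧ (∀ r ∈ rs, r ∈ maximalIdeal R) ∧ IsWeaklyRegular N rs ∧
      Module.length R (M ⧸ (Ideal.ofList rs • ⊤ : Submodule R M)) ≠ ⊤ ∧
      HasLeadingCoeff (hilbertSamuel R M) d
        (Module.length R (M ⧸ (Ideal.ofList rs • ⊤ : Submodule R M))).toNat ∧
      HasLeadingCoeff (hilbertSamuel R L) d
        (Module.length R (L ⧸ (Ideal.ofList rs • ⊤ : Submodule R L))).toNat := by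
  induction d generalizing L M N with
  | zero =>
    have hM0 : (Ideal.ofList ([] : List R) • ⊤ : Submodule R M) = ⊥ := by simp
    have hL0 : (Ideal.ofList ([] : List R) • ⊤ : Submodule R L) = ⊥ := by simp
    obtain ⟨c, hc⟩ := exists_pow_smul_eq_bot_of_supportDim_le_zero (R := R) (M := M)
      (by exact_mod_cast hdim)
    have hcL : (maximalIdeal R ^ c • ⊤ : Submodule R L) = ⊥ := by
      apply Submodule.map_injective_of_injective hf
      rw [Submodule.map_bot, eq_bot_iff, ← hc, Submodule.map_smul'']
      exact Submodule.smul_mono le_rfl le_top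
    refine ⟨[], rfl, by simp, IsWeaklyRegular.nil R N, ?_⟩
    rw [(Submodule.quotEquivOfEqBot _ hM0).length_eq, (Submodule.quotEquivOfEqBot _ hL0).length_eq]
    exact ⟨length_ne_top_of_pow_smul_eq_bot hc, hasLeadingCoeff_of_pow_smul_eq_bot hc,
      hasLeadingCoeff_of_pow_smul_eq_bot hcL⟩
  | succ d ih =>
    obtain ⟨y, hy, hyM, hyN, hsM, hsL⟩ := exists_regular_superficial (C := M) (D := L) hM hN
    have hyL : IsSMulRegular L y := hyM.of_injective f hf
    have hdim' : Module.supportDim R (QuotSMulTop y M) ≤ d := by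
      have h1 := Module.supportDim_quotSMulTop_succ_eq_supportDim hyM hy
      rw [← h1] at hdim
      push_cast at hdim
      exact ENat.WithBot.add_le_add_one_right_iff.1 hdim
    -- `0 → L → M → N → 0` stays exact after division by `y`, which is regular on `N`.
    have h0 : Function.Exact (0 : PUnit.{v + 1} →ₗ[R] L) f :=
      (LinearMap.exact_zero_iff_injective _ _).2 hf
    have hf' : Function.Injective (QuotSMulTop.map y f) := by
      have := QuotSMulTop.map_first_exact_on_four_term_exact_of_isSMulRegular_last h0 hfg hyN
      rw [map_zero] at this
      exact (LinearMap.exact_zero_iff_injective _ _).1 this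
    obtain ⟨rs, h1, h2, h3, h4, h5, h6⟩ := ih hf' (QuotSMulTop.map_exact y hfg hg)
      (QuotSMulTop.map_surjective y hg) (hM.quotSMulTop hyM hy) (hN.quotSMulTop hyN hy) hdim'
    refine ⟨y :: rs, by simp [h1], by simpa using ⟨hy, h2⟩, IsWeaklyRegular.cons hyN h3, ?_⟩
    rw [(Submodule.quotOfListConsSMulTopEquivQuotSMulTopInner M y rs).length_eq,
      (Submodule.quotOfListConsSMulTopEquivQuotSMulTopInner L y rs).length_eq]
    exact ⟨h4, h5.of_quotSMulTop hy hyM hsM, h6.of_quotSMulTop hy hyL hsL⟩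

lemma range_le_maximalIdeal_smul {L M N : Type*} [AddCommGroup L] [Module R L]
    [AddCommGroup M] [Module R M] [Module.Finite R M]
    [AddCommGroup N] [Module R N] [Module.Finite R N]
    {f : L →ₗ[R] M} {g : M →ₗ[R] N}
    (hfg : Function.Exact f g) (hg : Function.Surjective g)
    (h : hilbertSamuel R M 0 = hilbertSamuel R N 0) (l : L) :
    f l ∈ (maximalIdeal R • ⊤ : Submodule R M) := by
  have h1 : (maximalIdeal R ^ (0 + 1) • ⊤ : Submodule R N) =
      (maximalIdeal R ^ (0 + 1) • ⊤ : Submodule R M).map g := by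
    rw [Submodule.map_smul'', Submodule.map_top, LinearMap.range_eq_top.2 hg]
  have h2 : Function.Surjective
      ((maximalIdeal R ^ (0 + 1) • ⊤ : Submodule R N).mkQ.comp g) :=
    (Submodule.mkQ_surjective _).comp hg
  have h3 := (((maximalIdeal R ^ (0 + 1) • ⊤ : Submodule R N).mkQ.comp g).quotKerEquivOfSurjective
    h2).length_eq
  rw [← coe_hilbertSamuel, ← h, coe_hilbertSamuel] at h3
  rw [LinearMap.ker_comp, Submodule.ker_mkQ] at h3
  have h4 := eq_of_le_of_length_quotient_le
    (A := (maximalIdeal R ^ (0 + 1) • ⊤ : Submodule R M))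
    (B := (maximalIdeal R ^ (0 + 1) • ⊤ : Submodule R N).comap g)
    (h1 ▸ Submodule.le_comap_map _ _) h3.ge (h3 ▸ length_quotient_ne_top le_rfl)
  rw [zero_add, pow_one] at h4
  rw [h4, Submodule.mem_comap, hfg.apply_apply_eq_zero]
  exact zero_mem _

/-- The theorem over an infinite residue field, in terms of Hilbert-Samuel functions. -/
lemma tendsto_hilbertSamuel_of_infinite [Small.{v} R] [Infinite (ResidueField R)] {d : ℕ}
    {L M N : Type v} [AddCommGroup L] [Module R L] [Module.Finite R L]
    [AddCommGroup M] [Module R M] [Module.Finite R M]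
    [AddCommGroup N] [Module R N] [Module.Finite R N]
    {f : L →ₗ[R] M} {g : M →ₗ[R] N} (hf : Function.Injective f)
    (hfg : Function.Exact f g) (hg : Function.Surjective g)
    (hM : HasDepth R M d) (hN : HasDepth R N d) (hdim : Module.supportDim R M ≤ d)
    (hgens : hilbertSamuel R M 0 = hilbertSamuel R N 0)
    (hmin : Tendsto (fun n : ℕ ↦ (d.factorial : ℝ) / (n : ℝ) ^ d * hilbertSamuel R M n) atTop
      (𝓝 (hilbertSamuel R M 1 - d * hilbertSamuel R M 0))) :
    Tendsto (fun n : ℕ ↦ (d.factorial : ℝ) / (n : ℝ) ^ d * hilbertSamuel R L n) atTop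
      (𝓝 (hilbertSamuel R L 0)) := by
  obtain ⟨rs, rfl, h2, h3, h4, h5, h6⟩ := exists_superficial_sequence d hf hfg hg hM hN hdim
  have hJ : Ideal.ofList rs ≤ maximalIdeal R := Ideal.span_le.2 h2
  -- `e(M)` is the length of `M / yM`, so minimal multiplicity computes `H(1)`.
  have he := tendsto_nhds_unique h5.tendsto hmin
  have hH : (hilbertSamuel R M 1 : ℕ∞) =
      Module.length R (M ⧸ (Ideal.ofList rs • ⊤ : Submodule R M)) +
        rs.length * hilbertSamuel R M 0 := by
    rw [← ENat.natCast_toNat h4]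
    rw [eq_sub_iff_add_eq] at he
    exact_mod_cast he.symm
  have hJm : Ideal.ofList rs • maximalIdeal R • (⊤ : Submodule R M) =
      maximalIdeal R ^ (1 + 1) • ⊤ := by
    have hle : Ideal.ofList rs • maximalIdeal R • (⊤ : Submodule R M) ≤
        maximalIdeal R ^ (1 + 1) • ⊤ := by
      rw [pow_succ, pow_one, Submodule.mul_smul]
      exact Submodule.smul_mono_left hJ
    refine eq_of_le_of_length_quotient_le hle ?_ (length_quotient_ne_top le_rfl)
    rw [← coe_hilbertSamuel, hH, coe_hilbertSamuel, zero_add, pow_one]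
    exact length_quotient_ofList_smul_le rs _
  have h0 : Function.Exact (0 : PUnit.{v + 1} →ₗ[R] L) f :=
    (LinearMap.exact_zero_iff_injective _ _).2 hf
  have hex := map_first_exact_on_four_term_right_exact_of_isSMulRegular_last h0 hfg hg h3
  -- `𝔪L ⊆ 𝔪²M ∩ L ⊆ yM ∩ L = yL`.
  have hmL : (Ideal.ofList rs • ⊤ : Submodule R L) = maximalIdeal R ^ (0 + 1) • ⊤ := by
    rw [zero_add, pow_one]
    refine le_antisymm (Submodule.smul_mono_left hJ) ?_
    rw [Submodule.smul_le]
    intro r hr l _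
    have h7 : f (r • l) ∈ (Ideal.ofList rs • ⊤ : Submodule R M) := by
      refine Submodule.smul_mono le_rfl le_top (?_ : _ ∈ Ideal.ofList rs • maximalIdeal R • ⊤)
      rw [hJm, map_smul, pow_succ, pow_one, Submodule.mul_smul]
      exact Submodule.smul_mem_smul hr (range_le_maximalIdeal_smul hfg hg hgens l)
    obtain ⟨x, hx⟩ := (hex (Submodule.Quotient.mk (r • l))).1 (by
      rw [Submodule.mapQ_apply]
      exact (Submodule.Quotient.mk_eq_zero _).2 h7)
    rw [← Submodule.Quotient.mk_eq_zero, ← hx]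
    obtain ⟨x, rfl⟩ := Submodule.Quotient.mk_surjective _ x
    simp
  rw [hmL] at h6
  exact h6.tendsto

end

end UlrichCM

/-! ### Extension of the residue field -/

namespace UlrichCM

open RingTheory.Sequence TensorProduct

universe u

/-- The localization of `R[X]` at `mR[X]` is a flat local extension of `R` with the same maximal
ideal and an infinite residue field. -/
lemma exists_flat_extension_infinite_residueField (R : Type u) [CommRing R] [IsLocalRing R]
    [IsNoetherianRing R] :
    ∃ (S : Type u) (_ : CommRing S) (_ : IsLocalRing S) (_ : IsNoetherianRing S) (_ : Algebra R S),
      Module.Flat R S ∧ (maximalIdeal R).map (algebraMap R S) = maximalIdeal S ∧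
      Infinite (ResidueField S) := by
  let P : Ideal (Polynomial R) := (maximalIdeal R).map Polynomial.C
  have hP : P.IsPrime := Ideal.isPrime_map_C_of_isPrime
  refine ⟨Localization.AtPrime P, inferInstance, inferInstance,
    IsLocalization.isNoetherianRing P.primeCompl _ inferInstance, inferInstance,
    Module.Flat.trans R (Polynomial R) _, ?_, ?_⟩
  · rw [← Localization.AtPrime.map_eq_maximalIdeal, IsScalarTower.algebraMap_eq R (Polynomial R),
      ← Ideal.map_map]
    rfl
  · -- The powers of the variable have distinct images in the residue field.
    refine Infinite.of_injective (fun n : ℕ ↦ residue (Localization.AtPrime P)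
      (algebraMap (Polynomial R) _ (Polynomial.X ^ n))) fun i j hij ↦ ?_
    by_contra hne
    have h1 : (Polynomial.X ^ i - Polynomial.X ^ j : Polynomial R) ∈ P := by
      have h2 : algebraMap (Polynomial R) (Localization.AtPrime P)
          (Polynomial.X ^ i - Polynomial.X ^ j) ∈ maximalIdeal (Localization.AtPrime P) := by
        rw [← residue_eq_zero_iff, map_sub, map_sub]
        exact sub_eq_zero.2 hij
      exact (IsLocalization.AtPrime.to_map_mem_maximal_iff _ P _).1 h2
    have h2 := Ideal.mem_map_C_iff.1 h1 i
    rw [Polynomial.coeff_sub, Polynomial.coeff_X_pow_self, Polynomial.coeff_X_pow, if_neg hne,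
      sub_zero] at h2
    exact (Ideal.ne_top_iff_one _).1 (maximalIdeal.isMaximal R).ne_top h2

section

variable {R : Type*} [CommRing R] {M : Type*} [AddCommGroup M] [Module R M]
  (S : Type*) [CommRing S] [Algebra R S]

lemma baseChange_ideal_smul_top (I : Ideal R) :
    (I • ⊤ : Submodule R M).baseChange S =
      (I.map (algebraMap R S) • ⊤ : Submodule S (S ⊗[R] M)) := by
  apply le_antisymm
  · rw [Submodule.baseChange_eq_span, Submodule.span_le]
    rintro _ ⟨x, hx, rfl⟩
    induction hx using Submodule.smul_induction_on' with
    | smul r hr u _ =>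
      rw [map_smul, ← algebraMap_smul S r]
      exact Submodule.smul_mem_smul (Ideal.mem_map_of_mem _ hr) Submodule.mem_top
    | add x _ y _ hx hy =>
      rw [map_add]
      exact add_mem hx hy
  · rw [Ideal.map, Submodule.smul_le]
    intro r hr
    induction hr using Submodule.span_induction with
    | mem r hr =>
      obtain ⟨r, hr, rfl⟩ := hr
      intro u _
      induction u with
      | zero => simp
      | tmul s x =>
        rw [algebraMap_smul, ← TensorProduct.tmul_smul]
        exact Submodule.tmul_mem_baseChange_of_mem s
          (Submodule.smul_mem_smul hr Submodule.mem_top)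
      | add x y hx hy =>
        rw [smul_add]
        exact add_mem (hx Submodule.mem_top) (hy Submodule.mem_top)
    | zero => simp
    | add x y _ _ hx hy =>
      intro u hu
      rw [add_smul]
      exact add_mem (hx u hu) (hy u hu)
    | smul a x _ hx =>
      intro u hu
      rw [smul_assoc]
      exact Submodule.smul_mem _ _ (hx u hu)

lemma length_baseChange_quotient (P : Submodule R M) :
    Module.length S (S ⊗[R] (M ⧸ P)) = Module.length S ((S ⊗[R] M) ⧸ P.baseChange S) := by
  have hk : LinearMap.ker (P.mkQ.baseChange S) = P.baseChange S := by
    ext x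
    have := lTensor_exact S (LinearMap.exact_subtype_mkQ P) P.mkQ_surjective x
    rw [LinearMap.mem_ker]
    change LinearMap.lTensor S P.mkQ x = 0 ↔ _
    rw [this]
    rfl
  rw [← hk]
  exact ((P.mkQ.baseChange S).quotKerEquivOfSurjective
    (LinearMap.lTensor_surjective S P.mkQ_surjective)).length_eq.symm

variable [IsLocalRing R] [IsLocalRing S] [Module.Flat R S]

lemma length_baseChange_of_map_maximalIdeal_eq
    (h : (maximalIdeal R).map (algebraMap R S) = maximalIdeal S) :
    Module.length S (S ⊗[R] M) = Module.length R M := by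
  have : IsLocalHom (algebraMap R S) := ((local_hom_TFAE (algebraMap R S)).out 0 2).2 h.le
  have : IsSimpleModule S (S ⧸ maximalIdeal S) :=
    isSimpleModule_iff_isCoatom.2 (maximalIdeal.isMaximal S).out
  rw [IsLocalRing.length_baseChange, h, Module.length_eq_one S (S ⧸ maximalIdeal S), mul_one]

lemma hilbertSamuel_baseChange (h : (maximalIdeal R).map (algebraMap R S) = maximalIdeal S)
    (n : ℕ) : hilbertSamuel S (S ⊗[R] M) n = hilbertSamuel R M n := by
  unfold hilbertSamuel
  rw [← h, ← Ideal.map_pow, ← baseChange_ideal_smul_top, ← length_baseChange_quotient,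
    length_baseChange_of_map_maximalIdeal_eq S h]

lemma HasDepth.baseChange (h : (maximalIdeal R).map (algebraMap R S) = maximalIdeal S) {k : ℕ}
    (hM : HasDepth R M k) : HasDepth S (S ⊗[R] M) k := by
  have : IsLocalHom (algebraMap R S) := ((local_hom_TFAE (algebraMap R S)).out 0 2).2 h.le
  have : Module.FaithfullyFlat R S := Module.FaithfullyFlat.of_flat_of_isLocalHom
  obtain ⟨rs, h1, h2, h3⟩ := hM
  refine ⟨rs.map (algebraMap R S), by simpa using h1, ?_,
    h3.of_faithfullyFlat_of_isBaseChange (TensorProduct.isBaseChange R M S)⟩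
  intro s hs
  obtain ⟨r, hr, rfl⟩ := List.mem_map.1 hs
  exact h ▸ Ideal.mem_map_of_mem _ (h2 r hr)

end

lemma supportDim_le_zero_of_pow_smul_eq_bot {R : Type*} [CommRing R] [IsLocalRing R] {M : Type*}
    [AddCommGroup M] [Module R M] [Module.Finite R M] {c : ℕ}
    (h : (maximalIdeal R ^ c • ⊤ : Submodule R M) = ⊥) : Module.supportDim R M ≤ 0 := by
  have hs : Subsingleton (Module.support R M) := by
    have h1 : ∀ p ∈ Module.support R M, p = closedPoint R := by
      intro p hp
      rw [Module.support_eq_zeroLocus, PrimeSpectrum.mem_zeroLocus] at hp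
      have h2 : maximalIdeal R ^ c ≤ p.asIdeal := fun r hr ↦ hp (Module.mem_annihilator.2 fun m ↦ by
        rw [← Submodule.mem_bot R, ← h]
        exact Submodule.smul_mem_smul hr Submodule.mem_top)
      apply PrimeSpectrum.ext
      exact le_antisymm (le_maximalIdeal p.2.ne_top) (p.2.le_of_pow_le h2)
    exact ⟨fun p q ↦ Subtype.ext ((h1 p p.2).trans (h1 q q.2).symm)⟩
  exact Order.krullDim_nonpos_of_subsingleton

/-- The dimension of a Cohen-Macaulay module does not grow under a flat local extension with the
same maximal ideal, since a maximal regular sequence remains one with quotient of finite length. -/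
lemma supportDim_baseChange_le {R : Type*} [CommRing R] [IsLocalRing R] [IsNoetherianRing R]
    {M : Type*} [AddCommGroup M] [Module R M] [Module.Finite R M]
    (S : Type*) [CommRing S] [IsLocalRing S] [IsNoetherianRing S] [Algebra R S] [Module.Flat R S]
    (h : (maximalIdeal R).map (algebraMap R S) = maximalIdeal S) {d : ℕ}
    (hM : HasDepth R M d) (hdim : Module.supportDim R M ≤ d) :
    Module.supportDim S (S ⊗[R] M) ≤ d := by
  have : IsLocalHom (algebraMap R S) := ((local_hom_TFAE (algebraMap R S)).out 0 2).2 h.le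
  have : Module.FaithfullyFlat R S := Module.FaithfullyFlat.of_flat_of_isLocalHom
  obtain ⟨rs, rfl, h2, h3⟩ := hM
  have h4 : Module.supportDim R (M ⧸ (Ideal.ofList rs • ⊤ : Submodule R M)) ≤ 0 := by
    rw [← Module.supportDim_add_length_eq_supportDim_of_isRegular rs h3] at hdim
    exact ENat.WithBot.add_le_add_natCast_right_iff.1 (hdim.trans_eq (zero_add _).symm)
  obtain ⟨c, hc⟩ := exists_pow_smul_eq_bot_of_supportDim_le_zero h4
  have h5 : (maximalIdeal R ^ c • ⊤ : Submodule R M) ≤ Ideal.ofList rs • ⊤ := by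
    rw [← Submodule.ker_mkQ (Ideal.ofList rs • ⊤ : Submodule R M), LinearMap.le_ker_iff_map,
      Submodule.map_smul'', Submodule.map_top, Submodule.range_mkQ, hc]
  have h6 := Submodule.baseChange_mono S h5
  rw [baseChange_ideal_smul_top, baseChange_ideal_smul_top, Ideal.map_pow, h,
    Ideal.map_ofList] at h6
  have h7 := h3.of_faithfullyFlat_of_isBaseChange (TensorProduct.isBaseChange R M S)
  rw [← Module.supportDim_add_length_eq_supportDim_of_isRegular _ h7, List.length_map]
  refine (add_le_add_left (supportDim_le_zero_of_pow_smul_eq_bot (c := c) ?_) _).trans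
    (zero_add _).le
  rwa [← LinearMap.range_eq_top.2 (Submodule.mkQ_surjective (Ideal.ofList (rs.map (algebraMap R S))
    • ⊤ : Submodule S (S ⊗[R] M))), LinearMap.range_eq_map, ← Submodule.map_smul'',
    ← LinearMap.le_ker_iff_map, Submodule.ker_mkQ]

end UlrichCM

/-! ### Numerical invariants and the general case -/

namespace UlrichCM

open RingTheory.Sequence TensorProduct

universe u v w x

/-- The theorem in terms of Hilbert-Samuel functions: after a flat extension of the base ring the
residue field is infinite. -/
lemma tendsto_hilbertSamuel {R : Type u} [CommRing R] [IsLocalRing R] [IsNoetherianRing R] {d : ℕ}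
    {L M N : Type (max u v)} [AddCommGroup L] [Module R L] [Module.Finite R L]
    [AddCommGroup M] [Module R M] [Module.Finite R M]
    [AddCommGroup N] [Module R N] [Module.Finite R N]
    {f : L →ₗ[R] M} {g : M →ₗ[R] N} (hf : Function.Injective f)
    (hfg : Function.Exact f g) (hg : Function.Surjective g)
    (hM : HasDepth R M d) (hN : HasDepth R N d) (hdim : Module.supportDim R M ≤ d)
    (hgens : hilbertSamuel R M 0 = hilbertSamuel R N 0)
    (hmin : Tendsto (fun n : ℕ ↦ (d.factorial : ℝ) / (n : ℝ) ^ d * hilbertSamuel R M n) atTop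
      (𝓝 (hilbertSamuel R M 1 - d * hilbertSamuel R M 0))) :
    Tendsto (fun n : ℕ ↦ (d.factorial : ℝ) / (n : ℝ) ^ d * hilbertSamuel R L n) atTop
      (𝓝 (hilbertSamuel R L 0)) := by
  obtain ⟨S, _, _, _, _, _, h, _⟩ := exists_flat_extension_infinite_residueField R
  have := tendsto_hilbertSamuel_of_infinite (R := S) (d := d)
    (f := f.baseChange S) (g := g.baseChange S)
    (Module.Flat.lTensor_preserves_injective_linearMap f hf)
    (lTensor_exact S hfg hg) (LinearMap.lTensor_surjective S hg)
    (hM.baseChange S h) (hN.baseChange S h) (supportDim_baseChange_le S h hM hdim)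
  simp only [hilbertSamuel_baseChange S h] at this
  exact this hgens hmin

section

variable {R : Type*} [CommRing R] [IsLocalRing R] {M : Type*} [AddCommGroup M] [Module R M]

lemma HasDepth.le_depth {k : ℕ} (h : HasDepth R M k) : (k : ℕ∞) ≤ depth R M := by
  obtain ⟨rs, rfl, h2, h3⟩ := h
  exact le_iSup (fun rs : {rs : List R // (∀ x ∈ rs, x ∈ maximalIdeal R) ∧ IsRegular M rs} ↦
    (rs.1.length : ℕ∞)) ⟨rs, h2, h3⟩

lemma hasDepth_of_depth_eq [Nontrivial M] {k : ℕ} (h : depth R M = k) : HasDepth R M k := by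
  have : Nonempty {rs : List R // (∀ x ∈ rs, x ∈ maximalIdeal R) ∧ IsRegular M rs} :=
    ⟨[], by simp, IsRegular.nil R M⟩
  obtain ⟨⟨rs, h2, h3⟩, h1⟩ := ENat.exists_eq_iSup_of_lt_top
    (f := fun rs : {rs : List R // (∀ x ∈ rs, x ∈ maximalIdeal R) ∧ IsRegular M rs} ↦
      (rs.1.length : ℕ∞)) (h ▸ ENat.natCast_lt_top k : depth R M < ⊤)
  refine ⟨rs, ?_, h2, h3⟩
  have h4 : (rs.length : ℕ∞) = k := h1.trans h
  exact_mod_cast h4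

variable [IsNoetherianRing R]

lemma exists_supportDim_eq_natCast [Nontrivial M] : ∃ d : ℕ, Module.supportDim R M = d := by
  obtain ⟨e, he⟩ := WithBot.ne_bot_iff_exists.1
    (Module.supportDim_ne_bot_of_nontrivial (R := R) (M := M))
  have h1 : e ≠ ⊤ := by
    rintro rfl
    have := Module.supportDim_le_ringKrullDim R M
    rw [← he] at this
    exact (this.trans_lt ringKrullDim_lt_top).ne rfl
  lift e to ℕ using h1
  exact ⟨e, he.symm⟩

variable [Module.Finite R M]

lemma minGens_eq_hilbertSamuel_zero : minGens R M = hilbertSamuel R M 0 := by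
  have h := IsLocalRing.spanFinrank_eq_finrank_quotient (⊤ : Submodule R M)
    (Module.finite_def.1 inferInstance)
  rw [minGens, h, hilbertSamuel_congr (Submodule.topEquiv (R := R) (M := M)).symm]
  have h2 := coe_hilbertSamuel (R := R) (M := (⊤ : Submodule R M)) 0
  rw [zero_add, pow_one, length_quotient_maximalIdeal_smul] at h2
  exact_mod_cast h2.symm

lemma hilbertSamuel_one : hilbertSamuel R M 1 =
    minGens R (maximalIdeal R • ⊤ : Submodule R M) + minGens R M := by
  rw [minGens_eq_hilbertSamuel_zero, minGens_eq_hilbertSamuel_zero]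
  let P : Submodule R M := maximalIdeal R ^ (0 + 1) • ⊤
  change _ = hilbertSamuel R (maximalIdeal R • ⊤ : Submodule R M) 0 + _
  have hP : P = maximalIdeal R • ⊤ := by simp [P]
  rw [← hP]
  have h1 : (maximalIdeal R ^ (0 + 1) • ⊤ : Submodule R P).map P.subtype =
      maximalIdeal R ^ (1 + 1) • ⊤ := by
    rw [Submodule.map_smul'', Submodule.map_top, Submodule.range_subtype, ← Submodule.mul_smul,
      ← pow_add]
  have h2 : (maximalIdeal R ^ (1 + 1) • ⊤ : Submodule R M) ≤ P :=
    Submodule.smul_mono_left (Ideal.pow_le_pow_right (by omega))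
  have h3 := Module.length_eq_add_of_exact
    (Submodule.mapQ (maximalIdeal R ^ (0 + 1) • ⊤) (maximalIdeal R ^ (1 + 1) • ⊤) P.subtype
      (h1 ▸ Submodule.le_comap_map _ _))
    (Submodule.factor h2) ?_ (Submodule.factor_surjective h2) ?_
  · rw [← coe_hilbertSamuel, ← coe_hilbertSamuel, ← coe_hilbertSamuel] at h3
    exact_mod_cast h3
  · rw [← LinearMap.ker_eq_bot]
    refine Submodule.ker_liftQ_eq_bot _ _ _ ?_
    rw [LinearMap.ker_comp, Submodule.ker_mkQ, ← h1,
      Submodule.comap_map_eq_of_injective P.injective_subtype]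
  · intro y
    obtain ⟨y, rfl⟩ := Submodule.Quotient.mk_surjective _ y
    change (Submodule.Quotient.mk y : M ⧸ P) = 0 ↔ _
    constructor
    · intro hy
      exact ⟨Submodule.Quotient.mk ⟨y, (Submodule.Quotient.mk_eq_zero _).1 hy⟩, rfl⟩
    · rintro ⟨z, hz⟩
      obtain ⟨z, rfl⟩ := Submodule.Quotient.mk_surjective _ z
      have hz' := congrArg (Submodule.factor h2) hz
      change _ = (Submodule.Quotient.mk y : M ⧸ P) at hz'
      rw [← hz']
      exact (Submodule.Quotient.mk_eq_zero _).2 z.2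

lemma depth_le_supportDim [Nontrivial M] : (depth R M : WithBot ℕ∞) ≤ Module.supportDim R M := by
  obtain ⟨e, he⟩ := WithBot.ne_bot_iff_exists.1
    (Module.supportDim_ne_bot_of_nontrivial (R := R) (M := M))
  rw [← he, WithBot.coe_le_coe]
  refine iSup_le fun ⟨rs, h2, h3⟩ ↦ ?_
  rw [← WithBot.coe_le_coe, he, ← Module.supportDim_add_length_eq_supportDim_of_isRegular rs h3]
  have := h3.quot_ofList_smul_nontrivial ⊤
  obtain ⟨e', he'⟩ := WithBot.ne_bot_iff_exists.1 (Module.supportDim_ne_bot_of_nontrivial (R := R)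
    (M := M ⧸ (Ideal.ofList rs • ⊤ : Submodule R M)))
  rw [← he']
  change ((rs.length : ℕ∞) : WithBot ℕ∞) ≤ (e' : WithBot ℕ∞) + ((rs.length : ℕ∞) : WithBot ℕ∞)
  rw [← WithBot.coe_add, WithBot.coe_le_coe]
  exact le_add_self

end

/-- The theorem, with the common dimension `d` of `M` and `N` made explicit. -/
lemma isUlrich_of_exact {R : Type u} [CommRing R] [IsLocalRing R] [IsNoetherianRing R]
    {L : Type v} {M : Type w} {N : Type x} [AddCommGroup L] [Module R L] [Module.Finite R L]
    [AddCommGroup M] [Module R M] [Module.Finite R M]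
    [AddCommGroup N] [Module R N] [Module.Finite R N] [Nontrivial L] {d : ℕ}
    {f : L →ₗ[R] M} {g : M →ₗ[R] N} (hf : Function.Injective f)
    (hfg : Function.Exact f g) (hg : Function.Surjective g)
    (hM : HasDepth R M d) (hN : HasDepth R N d) (hdim : Module.supportDim R M = d)
    (hgens : minGens R M = minGens R N) (hmin : HasMinimalMultiplicity R M) : IsUlrich R L := by
  -- `Ext` requires the three modules to live in one universe.
  let eL : L ≃ₗ[R] ULift.{max u w x} L := ULift.moduleEquiv.symm
  let eM : M ≃ₗ[R] ULift.{max u v x} M := ULift.moduleEquiv.symm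
  let eN : N ≃ₗ[R] ULift.{max u v w} N := ULift.moduleEquiv.symm
  let f' : ULift.{max u w x} L →ₗ[R] ULift.{max u v x} M := eM ∘ₗ f ∘ₗ eL.symm
  let g' : ULift.{max u v x} M →ₗ[R] ULift.{max u v w} N := eN ∘ₗ g ∘ₗ eM.symm
  have hf' : Function.Injective f' := eM.injective.comp (hf.comp eL.symm.injective)
  have hg' : Function.Surjective g' := eN.surjective.comp (hg.comp eM.symm.surjective)
  have hfg' : Function.Exact f' g' :=
    (Function.Exact.iff_of_ladder_linearEquiv (e₁ := eL) (e₂ := eM) (e₃ := eN)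
      (LinearMap.ext fun _ ↦ rfl) (LinearMap.ext fun _ ↦ rfl)).2 hfg
  have hM' := hM.congr eM
  have hN' := hN.congr eN
  have hL : HasDepth R L d := by
    have : Small.{max u v w x} R := small_max.{max v w x} R
    exact (HasDepth.of_exact_left hf' hfg' hg' hM' hN').congr eL.symm
  have hdimL : Module.supportDim R L = d := by
    apply le_antisymm (hdim ▸ Module.supportDim_le_of_injective f hf)
    exact le_trans (WithBot.coe_le_coe.2 hL.le_depth) depth_le_supportDim
  have hdM : dimNat R M = d := by simp [dimNat, hdim]
  have hdL : dimNat R L = d := by simp [dimNat, hdimL]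
  refine ⟨inferInstance, Or.inr ?_, ?_⟩
  · apply le_antisymm depth_le_supportDim
    rw [hdimL]
    exact WithBot.coe_le_coe.2 hL.le_depth
  · have h1 := hmin.2
    unfold HasMultiplicity at h1 ⊢
    rw [hdM] at h1
    rw [hdL, minGens_eq_hilbertSamuel_zero]
    have h2 := tendsto_hilbertSamuel.{u, max v w x} hf' hfg' hg' hM' hN'
      (by rw [← Module.supportDim_eq_of_equiv eM, hdim])
    simp only [← hilbertSamuel_congr eL, ← hilbertSamuel_congr eM, ← hilbertSamuel_congr eN,
      ← minGens_eq_hilbertSamuel_zero] at h2 ⊢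
    refine h2 hgens ?_
    convert h1 using 2
    rw [hilbertSamuel_one]
    push_cast
    ring

end UlrichCM

theorem mainTheorem12 {R : Type*} [CommRing R] [IsNoetherianRing R] [IsLocalRing R]
    {L M N : Type*} [AddCommGroup L] [Module R L] [Module.Finite R L]
    [AddCommGroup M] [Module R M] [Module.Finite R M]
    [AddCommGroup N] [Module R N] [Module.Finite R N]
    (hM : UlrichCM.IsCM R M) (hN : UlrichCM.IsCM R N)
    (hdim : Module.supportDim R M = Module.supportDim R N)
    (hmin : UlrichCM.HasMinimalMultiplicity R M)
    (hgens : UlrichCM.minGens R M = UlrichCM.minGens R N)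
    (f : L →ₗ[R] M) (g : M →ₗ[R] N) (hf : Function.Injective f)
    (hfg : Function.Exact f g) (hg : Function.Surjective g) :
    Subsingleton L ∨ UlrichCM.IsUlrich R L := by
  rcases subsingleton_or_nontrivial L with hL | hL
  · exact Or.inl hL
  right
  have hMn : Nontrivial M := hf.nontrivial
  have hNn : Nontrivial N := by
    rw [← Module.supportDim_ne_bot_iff_nontrivial R, ← hdim,
      Module.supportDim_ne_bot_iff_nontrivial]
    exact hMn
  obtain ⟨d, hd⟩ := UlrichCM.exists_supportDim_eq_natCast (R := R) (M := M)
  have hM' := hM.resolve_left (not_subsingleton M)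
  have hN' := hN.resolve_left (not_subsingleton N)
  rw [hd] at hM'
  rw [← hdim, hd] at hN'
  exact UlrichCM.isUlrich_of_exact hf hfg hg
    (UlrichCM.hasDepth_of_depth_eq (WithBot.coe_injective hM'))
    (UlrichCM.hasDepth_of_depth_eq (WithBot.coe_injective hN')) hd hgens hmin
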